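/- Let $d\ge 4$ be an integer, and let $0<\varepsilon\le 1$ and $\delta>0$ be real numbers such that $\frac{d+2-\delta(d+1)}{3}-\varepsilon\ge 0$. There are constants $c_1,c_2,c_3>0$, depending only on $d,\varepsilon,\delta$, such that for every positive integer $m$ there exist a set $\mathcal P$ of $m$ points and a finite set $\Pi$ of $n$ hyperplanes, both in $\mathbb R^d$, with $$c_1\,m^{(3-3\varepsilon)/(d+1)}\le n\le c_2\,m^{(3-3\varepsilon)/(d+1)},$$ such that the incidence graph of $\mathcal P\times\Pi$ contains no copy of $K_{2,d/\varepsilon}$ (that is, no two distinct points of $\mathcal P$ lie together in $\lceil d/\varepsilon\rceil$ or more members of $\Pi$), and such that the number $I(\mathcal P,\Pi)$ of pairs $(p,V)\in\mathcal P\times\Pi$ with $p\in V$ satisfies $$I(\mathcal P,\Pi)\ge c_3\,m^{\delta}\,n^{(d+2-\delta(d+1))/3-\varepsilon}.$$ The same holds, with constants depending only on $d,\varepsilon,\delta$, when hyperplanes are replaced by hyperspheres (spheres of positive radius in $\mathbb R^d$), or by members of any given non-empty linearly-closed family $F$ of graphs. Here a graph is a set of the form $\{x\in\mathbb R^d: x_d=f(x_1,\dots,x_{d-1})\}$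 with an arbitrary function $f:\mathbb R^{d-1}\to\mathbb R$, and a family $F$ of graphs is linearly-closed if, whenever the graph $x_d=f(x_1,\dots,x_{d-1})$ is in $F$, the graph $x_d=f(x_1,\dots,x_{d-1})+a_1x_1+\dots+a_{d-1}x_{d-1}+a_d$ is in $F$ for all $a_1,\dots,a_d\in\mathbb R$. -/

import Mathlib

open scoped Finset

/-- A hyperplane of `ℝ^d`: the solution set of a single non-trivial linear equation. -/
def IsHyperplane {d : ℕ} (V : Set (EuclideanSpace ℝ (Fin d))) : Prop :=
  ∃ (a : EuclideanSpace ℝ (Fin d)) (b : ℝ), a ≠ 0 ∧ V = {x | ∑ i, a i * x i = b}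

/-- A hypersphere of `ℝ^d`, of positive radius. -/
def IsHypersphere {d : ℕ} (V : Set (EuclideanSpace ℝ (Fin d))) : Prop :=
  ∃ (c : EuclideanSpace ℝ (Fin d)) (r : ℝ), 0 < r ∧ V = Metric.sphere c r

/-- The graph `x_d = f(x_1, …, x_{d-1})` in `ℝ^d`, for an arbitrary function `f`.
Coordinates are numbered from `0`, so the last one has index `d - 1`. -/
def graphOf {d : ℕ} (hd : 0 < d) (f : (Fin (d - 1) → ℝ) → ℝ) :
    Set (EuclideanSpace ℝ (Fin d)) :=
  {x | x ⟨d - 1, Nat.sub_lt hd Nat.one_pos⟩ =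
    f (fun i => x ⟨i.val, lt_of_lt_of_le i.isLt (Nat.sub_le d 1)⟩)}

/-- `F` is a linearly-closed family of graphs in `ℝ^d`: all its members are graphs, and adding
an affine function of `x_1, …, x_{d-1}` to a defining function does not lead out of `F`. -/
def IsLinearlyClosed {d : ℕ} (hd : 0 < d) (F : Set (Set (EuclideanSpace ℝ (Fin d)))) : Prop :=
  (∀ V ∈ F, ∃ f : (Fin (d - 1) → ℝ) → ℝ, V = graphOf hd f) ∧
  ∀ f : (Fin (d - 1) → ℝ) → ℝ, graphOf hd f ∈ F →
    ∀ (a : Fin (d - 1) → ℝ) (b : ℝ), graphOf hd (fun x => f x + ∑ i, a i * x i + b) ∈ F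

/-- The number `I(P, H)` of pairs `(p, V)` with `p ∈ P`, `V ∈ H` and `p ∈ V`. -/
noncomputable def incidences {X : Type*} (P : Finset X) (H : Finset (Set X)) : ℕ :=
  Set.ncard {q : X × Set X | q.1 ∈ P ∧ q.2 ∈ H ∧ q.1 ∈ q.2}

/-- The incidence graph of `P × H` contains a copy of `K_{s,t}`: there are `s` points of `P`
and `t` members of `H` such that each of these points lies in each of these sets. -/
def ContainsK {X : Type*} (s t : ℕ) (P : Finset X) (H : Finset (Set X)) : Prop :=
  ∃ A ⊆ P, ∃ B ⊆ H, #A = s ∧ #B = t ∧ ∀ p ∈ A, ∀ V ∈ B, p ∈ V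

/-- There are a set `P` of `m` points of `ℝ^d` and a finite set `H` of `n` members of the class
`C`, with `c₁ m^((3-3ε)/(d+1)) ≤ n ≤ c₂ m^((3-3ε)/(d+1))`, whose incidence graph contains no
`K_{2,d/ε}` and which have at least `c₃ m^δ n^((d+2-δ(d+1))/3-ε)` incidences. -/
def HasConfiguration (d : ℕ) (ε δ c₁ c₂ c₃ : ℝ) (m : ℕ)
    (C : Set (EuclideanSpace ℝ (Fin d)) → Prop) : Prop :=
  ∃ (P : Finset (EuclideanSpace ℝ (Fin d))) (H : Finset (Set (EuclideanSpace ℝ (Fin d)))),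
    #P = m ∧
    (∀ V ∈ H, C V) ∧
    c₁ * (m : ℝ) ^ ((3 - 3 * ε) / ((d : ℝ) + 1)) ≤ (#H : ℝ) ∧
    (#H : ℝ) ≤ c₂ * (m : ℝ) ^ ((3 - 3 * ε) / ((d : ℝ) + 1)) ∧
    ¬ ContainsK 2 ⌈(d : ℝ) / ε⌉₊ P H ∧
    c₃ * ((m : ℝ) ^ δ * (#H : ℝ) ^ (((d : ℝ) + 2 - δ * ((d : ℝ) + 1)) / 3 - ε)) ≤
      (incidences P H : ℝ)

/-!
All three kinds of hypersurfaces realize the same incidence structure, that of the lattice points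
`(x, y)` and the hyperplanes `y = a · x + b` with `x`, `a` in `ℕ^(d-1)` and `y`, `b` in `ℕ`. For the
graphs of `f x + a · x + b` the point `(x, y)` is moved to `(x, f x + y)` (`graph_realization`;
hyperplanes are the case `f = 0`). For spheres it is moved to `(x, √(y + K - ‖x‖²))`, so that the
quadratic part of the equation of a sphere centred at `(a / 2, 0)` becomes `y + K`
(`sphere_realization`). Since the configuration below does not depend on the kind of hypersurface,
neither do the constants.

In the lattice, take the about `d k ^ (d + 1)` points with `x ∈ [0, k)^(d-1)` and `y < d k²`, where
`k` has order `m ^ (1 / (d + 1))`, and fill up to `m` points with points on no hyperplane. Each of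
the `k ^ (d + 1)` hyperplanes with `a ∈ [0, k)^(d-1)` and `b < k²` contains at least `k ^ (d - 1)`
of these points (`mul_pow_le_card_incident`), but two points lie together on at most `k ^ (d - 2)`
of them (`card_common_le`). Keep only a random set of `n ≈ k ^ (3 - 3 ε)` hyperplanes
(`exists_subset_card_inter_lt`). The expected number of kept hyperplanes through two given points
has order `k ^ (-3 ε)`, and the probability that there are `t ≥ d / ε` of them has order
`k ^ (-3 ε t) ≤ k ^ (-3 d)`, less than the inverse of the number of pairs of points, of order
`k ^ (2 d + 2)`, as soon as `k` is large (`sample_bound`). The number of incidences is at least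
`n k ^ (d - 1)`, whatever the choice.
-/

/-! ### Subsets with small intersections -/

/-- An `N`-subset of an `M`-set contains `t` given elements with probability at most `(N / M) ^ t`;
here in the form free of division. -/
theorem choose_sub_mul_pow_le {M N : ℕ} (h : N ≤ M) (t : ℕ) (ht : t ≤ N) :
    (M - t).choose (N - t) * M ^ t ≤ M.choose N * N ^ t := by
  induction t with
  | zero => simp
  | succ t ih =>
    have ih := ih (by omega)
    obtain ⟨n, hn⟩ : ∃ n, N = t + 1 + n := ⟨N - (t + 1), by omega⟩
    obtain ⟨r, hr⟩ : ∃ r, M = t + 1 + n + r := ⟨M - N, by omega⟩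
    have e1 : M - t = n + r + 1 := by omega
    have e2 : N - t = n + 1 := by omega
    have e3 : M - (t + 1) = n + r := by omega
    have e4 : N - (t + 1) = n := by omega
    rw [e1, e2] at ih
    rw [e3, e4]
    have key := Nat.add_one_mul_choose_eq (n + r) n
    have hfrac : M * (n + 1) ≤ N * (n + r + 1) := by
      subst hr hn; nlinarith [Nat.zero_le (t * r)]
    refine Nat.le_of_mul_le_mul_left (c := n + r + 1) ?_ (by omega)
    calc (n + r + 1) * ((n + r).choose n * M ^ (t + 1))
        = (n + r + 1) * (n + r).choose n * M ^ (t + 1) := by ring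
      _ = (n + r + 1).choose (n + 1) * M ^ t * (M * (n + 1)) := by rw [key]; ring
      _ ≤ (M.choose N * N ^ t) * (N * (n + r + 1)) := Nat.mul_le_mul ih hfrac
      _ = (n + r + 1) * (M.choose N * N ^ (t + 1)) := by ring

theorem card_filter_powersetCard_superset_le {α : Type*} [DecidableEq α] {U T : Finset α}
    (hT : T ⊆ U) (N : ℕ) :
    #{H ∈ U.powersetCard N | T ⊆ H} ≤ (#U - #T).choose (N - #T) := by
  rw [← Finset.card_sdiff_of_subset hT, ← Finset.card_powersetCard]
  refine Finset.card_le_card_of_injOn (fun H => H \ T) ?_ ?_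
  · intro H hH
    simp only [Finset.mem_coe, Finset.mem_filter, Finset.mem_powersetCard] at hH
    simp only [Finset.mem_coe, Finset.mem_powersetCard]
    exact ⟨Finset.sdiff_subset_sdiff hH.1.1 le_rfl, by
      rw [Finset.card_sdiff_of_subset hH.2, hH.1.2]⟩
  · intro H hH H' hH' e
    simp only [Finset.mem_coe, Finset.mem_filter] at hH hH'
    simp only at e
    rw [← Finset.sdiff_union_of_subset hH.2, e, Finset.sdiff_union_of_subset hH'.2]

/-- Among the `N`-subsets `H` of `U`, some one meets each of the given sets `S j`, of size at most
`s`, in fewer than `t` elements: the proportion of those containing `t` elements of a given `S j`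
is at most `(s N / #U) ^ t`, and the union bound applies. -/
theorem exists_subset_card_inter_lt {α κ : Type*} [DecidableEq α] (U : Finset α)
    (J : Finset κ) (S : κ → Finset α) {s N t : ℕ} (hSU : ∀ j ∈ J, S j ⊆ U)
    (hs : ∀ j ∈ J, #(S j) ≤ s) (hN : N ≤ #U) (hJ : #J * (s * N) ^ t < #U ^ t) :
    ∃ H ⊆ U, #H = N ∧ ∀ j ∈ J, #(S j ∩ H) < t := by
  classical
  by_contra! hcon
  have hcover : U.powersetCard N ⊆ J.biUnion fun j =>
      ((S j).powersetCard t).biUnion fun T => {H ∈ U.powersetCard N | T ⊆ H} := by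
    intro H hH
    obtain ⟨hHU, hHN⟩ := Finset.mem_powersetCard.1 hH
    obtain ⟨j, hj, hjt⟩ := hcon H hHU hHN
    obtain ⟨T, hT, hTt⟩ := Finset.exists_subset_card_eq hjt
    simp only [Finset.mem_biUnion, Finset.mem_powersetCard, Finset.mem_filter]
    exact ⟨j, hj, T, ⟨hT.trans Finset.inter_subset_left, hTt⟩, ⟨hHU, hHN⟩,
      hT.trans Finset.inter_subset_right⟩
  have hT : ∀ j ∈ J, ∀ T ∈ (S j).powersetCard t,
      #{H ∈ U.powersetCard N | T ⊆ H} * #U ^ t ≤ (#U).choose N * N ^ t := by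
    intro j hj T hT
    obtain ⟨hTS, rfl⟩ := Finset.mem_powersetCard.1 hT
    rcases le_or_gt #T N with h | h
    · exact (Nat.mul_le_mul_right _
        (card_filter_powersetCard_superset_le (hTS.trans (hSU j hj)) N)).trans
        (choose_sub_mul_pow_le hN _ h)
    · have : ({H ∈ U.powersetCard N | T ⊆ H} : Finset _) = ∅ := by
        refine Finset.filter_eq_empty_iff.2 fun H hH hTH => ?_
        have := Finset.card_le_card hTH
        rw [(Finset.mem_powersetCard.1 hH).2] at this
        omega
      simp [this]
  have hcount : (#U).choose N * #U ^ t ≤ (#U).choose N * (#J * (s * N) ^ t) := by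
    calc (#U).choose N * #U ^ t
        ≤ (∑ j ∈ J, ∑ T ∈ (S j).powersetCard t, #{H ∈ U.powersetCard N | T ⊆ H}) * #U ^ t := by
          refine Nat.mul_le_mul_right _ ?_
          rw [← Finset.card_powersetCard]
          refine (Finset.card_le_card hcover).trans (Finset.card_biUnion_le.trans ?_)
          exact Finset.sum_le_sum fun j _ => Finset.card_biUnion_le
      _ = ∑ j ∈ J, ∑ T ∈ (S j).powersetCard t, #{H ∈ U.powersetCard N | T ⊆ H} * #U ^ t := by
          simp only [Finset.sum_mul]
      _ ≤ ∑ j ∈ J, s ^ t * ((#U).choose N * N ^ t) := by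
          refine Finset.sum_le_sum fun j hj => (Finset.sum_le_card_nsmul _ _ _ (hT j hj)).trans ?_
          rw [smul_eq_mul, Finset.card_powersetCard]
          exact Nat.mul_le_mul_right _
            ((Nat.choose_le_pow _ _).trans (Nat.pow_le_pow_left (hs j hj) t))
      _ = (#U).choose N * (#J * (s * N) ^ t) := by
          rw [Finset.sum_const, smul_eq_mul, mul_pow]; ring
  exact absurd (Nat.le_of_mul_le_mul_left hcount (Nat.choose_pos hN)) (not_le.2 hJ)

/-! ### Incidences of lattice points with hyperplanes `y = a · x + b` -/

/-- The lattice point `p = (x, y)` lies on the hyperplane `y = a · x + b` encoded by `h = (a, b)`.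
Points and hyperplanes both have coordinates in `ℕ`. -/
def LatticeIncident {ι : Type*} [Fintype ι] (p h : (ι → ℕ) × ℕ) : Prop :=
  p.2 = ∑ i, h.1 i * p.1 i + h.2

/-- The box `[0, k)^ι × [0, l)`, which serves both as a set of points `(x, y)` and as a set of
hyperplanes `(a, b)`. -/
def latticeBox (ι : Type*) [Fintype ι] [DecidableEq ι] (k l : ℕ) : Finset ((ι → ℕ) × ℕ) :=
  Fintype.piFinset (fun _ => Finset.range k) ×ˢ Finset.range l

/-- A set of points can be enlarged to any given size by points on none of the given
hyperplanes. -/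
theorem exists_superset_card_eq_not_incident {ι : Type*} [Fintype ι]
    (B H : Finset ((ι → ℕ) × ℕ)) {m : ℕ} (hm : #B ≤ m) :
    ∃ P, B ⊆ P ∧ #P = m ∧ ∀ p ∈ P, p ∉ B → ∀ h ∈ H, ¬ LatticeIncident p h := by
  classical
  -- the points `(0, L + j)` lie above all points of `B` and above all `(0, b)` with `(a, b) ∈ H`
  let L := B.sup Prod.snd + H.sup Prod.snd + 1
  have hinj : Function.Injective fun j : ℕ => ((0 : ι → ℕ), L + j) := fun a b e => by
    simpa using e
  let Q := (Finset.range (m - #B)).image fun j : ℕ => ((0 : ι → ℕ), L + j)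
  have hdisj : Disjoint B Q := by
    refine Finset.disjoint_left.2 fun p hp hq => ?_
    obtain ⟨j, -, rfl⟩ := Finset.mem_image.1 hq
    have := Finset.le_sup (f := Prod.snd) hp
    simp only [L] at this
    omega
  refine ⟨B ∪ Q, Finset.subset_union_left, ?_, ?_⟩
  · rw [Finset.card_union_of_disjoint hdisj, Finset.card_image_of_injective _ hinj,
      Finset.card_range]
    omega
  · intro p hp hpB h hh
    obtain ⟨j, -, rfl⟩ := Finset.mem_image.1 ((Finset.mem_union.1 hp).resolve_left hpB)
    have := Finset.le_sup (f := Prod.snd) hh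
    simp only [LatticeIncident, L, Pi.zero_apply, mul_zero, Finset.sum_const_zero]
    omega

section Lattice

variable {ι : Type*} [Fintype ι] [DecidableEq ι]

theorem card_latticeBox (k l : ℕ) : #(latticeBox ι k l) = k ^ Fintype.card ι * l := by
  simp [latticeBox]

theorem mem_latticeBox {k l : ℕ} {p : (ι → ℕ) × ℕ} :
    p ∈ latticeBox ι k l ↔ (∀ i, p.1 i < k) ∧ p.2 < l := by
  simp [latticeBox]

open Classical in
/-- At most `k ^ (#ι - 1)` hyperplanes of the box pass through two distinct points: if the points
differ in `x i`, then `a i` and `b` are determined by the other coordinates of `a`. -/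
theorem card_common_le {p q : (ι → ℕ) × ℕ} (hpq : p ≠ q) (k l : ℕ) :
    #{h ∈ latticeBox ι k l | LatticeIncident p h ∧ LatticeIncident q h} ≤
      k ^ (Fintype.card ι - 1) := by
  by_cases hx : p.1 = q.1
  · have : ({h ∈ latticeBox ι k l | LatticeIncident p h ∧ LatticeIncident q h} : Finset _) = ∅ := by
      refine Finset.filter_eq_empty_iff.2 fun h _ hh => hpq (Prod.ext hx ?_)
      rw [hh.1, hh.2, hx]
    simp [this]
  obtain ⟨i, hi⟩ := Function.ne_iff.1 hx
  have hcard : #(Fintype.piFinset fun _ : {j // j ≠ i} => Finset.range k) =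
      k ^ (Fintype.card ι - 1) := by
    simp [Fintype.card_piFinset, Fintype.card_subtype_compl]
  rw [← hcard]
  refine Finset.card_le_card_of_injOn (fun h (j : {j // j ≠ i}) => h.1 j) ?_ ?_
  · intro h hh
    have hh := (mem_latticeBox.1 (Finset.mem_filter.1 (Finset.mem_coe.1 hh)).1).1
    simp only [Finset.mem_coe, Fintype.mem_piFinset, Finset.mem_range]
    exact fun j => hh j
  · intro h hh h' hh' e
    obtain ⟨-, h1, h2⟩ := Finset.mem_filter.1 (Finset.mem_coe.1 hh)
    obtain ⟨-, h3, h4⟩ := Finset.mem_filter.1 (Finset.mem_coe.1 hh')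
    have hoff : ∀ j, j ≠ i → h.1 j = h'.1 j := fun j hj => congrFun e ⟨j, hj⟩
    have hsum : ∀ x : ι → ℕ, ∑ j ∈ Finset.univ.erase i, h.1 j * x j =
        ∑ j ∈ Finset.univ.erase i, h'.1 j * x j := fun x =>
      Finset.sum_congr rfl fun j hj => by rw [hoff j (Finset.ne_of_mem_erase hj)]
    unfold LatticeIncident at h1 h2 h3 h4
    rw [← Finset.add_sum_erase _ _ (Finset.mem_univ i)] at h1 h2 h3 h4
    rw [hsum] at h1 h2
    have hai : h.1 i = h'.1 i := by
      have hz : ((h.1 i : ℤ) - h'.1 i) * ((p.1 i : ℤ) - q.1 i) = 0 := by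
        zify at h1 h2 h3 h4
        linear_combination h3 - h4 - h1 + h2
      rcases mul_eq_zero.1 hz with hz | hz
      · exact_mod_cast sub_eq_zero.1 hz
      · exact absurd (by exact_mod_cast sub_eq_zero.1 hz) hi
    have ha : h.1 = h'.1 := by
      funext j
      by_cases hj : j = i
      · rw [hj, hai]
      · exact hoff j hj
    refine Prod.ext ha ?_
    rw [hai] at h1
    omega

open Classical in
/-- Each hyperplane of the box passes through a point of the larger box over every
`x ∈ [0, k)^ι`. -/
theorem mul_pow_le_card_incident {k D : ℕ} (hD : Fintype.card ι < D) {P H : Finset ((ι → ℕ) × ℕ)}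
    (hP : latticeBox ι k (D * k ^ 2) ⊆ P) (hH : H ⊆ latticeBox ι k (k ^ 2)) :
    #H * k ^ Fintype.card ι ≤ #{x ∈ P ×ˢ H | LatticeIncident x.1 x.2} := by
  have hc : #(H ×ˢ Fintype.piFinset fun _ : ι => Finset.range k) =
      #H * k ^ Fintype.card ι := by simp
  rw [← hc]
  refine Finset.card_le_card_of_injOn
    (fun y => ((y.2, ∑ i, y.1.1 i * y.2 i + y.1.2), y.1)) ?_ ?_
  · rintro ⟨h, x⟩ hy
    simp only [Finset.coe_product, Set.mem_prod, Finset.mem_coe, Fintype.mem_piFinset,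
      Finset.mem_range] at hy
    obtain ⟨hh, hx⟩ := hy
    obtain ⟨ha, hb⟩ := mem_latticeBox.1 (hH hh)
    simp only [Finset.mem_coe, Finset.mem_filter, Finset.mem_product]
    refine ⟨⟨hP (mem_latticeBox.2 ⟨hx, ?_⟩), hh⟩, rfl⟩
    have hs : ∑ i, h.1 i * x i ≤ Fintype.card ι * k ^ 2 := by
      refine (Finset.sum_le_card_nsmul _ _ (k ^ 2) fun i _ => ?_).trans (by simp)
      rw [sq]
      exact Nat.mul_le_mul (ha i).le (hx i).le
    have : (Fintype.card ι + 1) * k ^ 2 ≤ D * k ^ 2 := Nat.mul_le_mul_right _ hD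
    simp only
    linarith
  · rintro ⟨h, x⟩ - ⟨h', x'⟩ - e
    simp only [Prod.mk.injEq] at e ⊢
    exact ⟨e.2, e.1.1⟩

end Lattice

/-! ### Random choice of hyperplanes -/

open Classical in
/-- Any two distinct points of `P` lie together on fewer than `t` hyperplanes of `H`. -/
def PairsOnFewerThan {ι : Type*} [Fintype ι] (t : ℕ) (P H : Finset ((ι → ℕ) × ℕ)) : Prop :=
  ∀ p ∈ P, ∀ q ∈ P, p ≠ q → #{h ∈ H | LatticeIncident p h ∧ LatticeIncident q h} < t

open Classical in
/-- A random set of `N` hyperplanes of the box `[0, k)^ι × [0, k²)`, together with the points of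
`[0, k)^ι × [0, D k²)` and `m - D k ^ (#ι + 2)` points on no hyperplane. -/
theorem exists_lattice_configuration {ι : Type*} [Fintype ι] {D k N t m : ℕ}
    (hD : Fintype.card ι < D) (ht : 0 < t)
    (hN : N ≤ k ^ Fintype.card ι * k ^ 2) (hm : k ^ Fintype.card ι * (D * k ^ 2) ≤ m)
    (hbound : (k ^ Fintype.card ι * (D * k ^ 2)) ^ 2 * (k ^ (Fintype.card ι - 1) * N) ^ t <
      (k ^ Fintype.card ι * k ^ 2) ^ t) :
    ∃ P H : Finset ((ι → ℕ) × ℕ), #P = m ∧ #H = N ∧ PairsOnFewerThan t P H ∧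
      N * k ^ Fintype.card ι ≤ #{x ∈ P ×ˢ H | LatticeIncident x.1 x.2} := by
  set B := latticeBox ι k (D * k ^ 2)
  set U := latticeBox ι k (k ^ 2)
  have hBc : #B = k ^ Fintype.card ι * (D * k ^ 2) := card_latticeBox _ _
  have hUc : #U = k ^ Fintype.card ι * k ^ 2 := card_latticeBox _ _
  obtain ⟨H, hHU, hHN, hH⟩ := exists_subset_card_inter_lt U B.offDiag
    (fun j => {h ∈ U | LatticeIncident j.1 h ∧ LatticeIncident j.2 h})
    (s := k ^ (Fintype.card ι - 1)) (N := N) (t := t)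
    (fun j _ => Finset.filter_subset _ _)
    (fun j hj => card_common_le (Finset.mem_offDiag.1 hj).2.2 _ _)
    (hN.trans_eq hUc.symm) (by
      rw [hUc]
      refine lt_of_le_of_lt (Nat.mul_le_mul_right _ ?_) hbound
      rw [Finset.offDiag_card, ← hBc, sq]
      exact Nat.sub_le _ _)
  obtain ⟨P, hBP, hPm, hP⟩ := exists_superset_card_eq_not_incident B H (hBc.le.trans hm)
  refine ⟨P, H, hPm, hHN, ?_, hHN ▸ mul_pow_le_card_incident hD hBP hHU⟩
  intro p hp q hq hpq
  by_cases hpB : p ∈ B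
  · by_cases hqB : q ∈ B
    · refine lt_of_le_of_lt (Finset.card_le_card fun h hh => ?_)
        (hH (p, q) (Finset.mem_offDiag.2 ⟨hpB, hqB, hpq⟩))
      obtain ⟨hhH, hh⟩ := Finset.mem_filter.1 hh
      exact Finset.mem_inter.2 ⟨Finset.mem_filter.2 ⟨hHU hhH, hh⟩, hhH⟩
    · rw [Finset.filter_false_of_mem fun h hh hpq => hP q hq hqB h hh hpq.2]
      simpa
  · rw [Finset.filter_false_of_mem fun h hh hpq => hP p hp hpB h hh hpq.1]
    simpa

open Classical in
/-- One hyperplane through at least one of `m` points, used for the small values of `m`. -/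
theorem exists_single_configuration {ι : Type*} [Fintype ι] {t m : ℕ} (ht : 1 < t) (hm : 1 ≤ m) :
    ∃ P H : Finset ((ι → ℕ) × ℕ), #P = m ∧ #H = 1 ∧ PairsOnFewerThan t P H ∧
      1 ≤ #{x ∈ P ×ˢ H | LatticeIncident x.1 x.2} := by
  obtain ⟨P, hP0, hPm, -⟩ := exists_superset_card_eq_not_incident
    {((0 : ι → ℕ), 0)} (∅ : Finset ((ι → ℕ) × ℕ)) (m := m) (by simpa)
  refine ⟨P, {(0, 0)}, hPm, rfl, fun p _ q _ _ => ?_, Finset.card_pos.2 ⟨((0, 0), (0, 0)), ?_⟩⟩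
  · exact lt_of_le_of_lt ((Finset.card_filter_le _ _).trans (by simp)) ht
  · simp only [Finset.mem_filter, Finset.mem_product, Finset.mem_singleton, and_true]
    exact ⟨hP0 (Finset.mem_singleton_self _), by simp [LatticeIncident]⟩

/-- The union bound succeeds with `e = d - 1` and `t ≥ d / ε`. With `N ≈ k ^ (3 - 3 ε)` out of
`k ^ (d + 1)` hyperplanes and at most `k ^ (d - 2)` of them through two points, the probability for
one pair of points is of order `k ^ (-3 ε t) ≤ k ^ (-3 d)`, and there are of order `k ^ (2 d + 2)`
pairs. -/
theorem sample_bound {e k N t : ℕ} {ε : ℝ} (he : 2 ≤ e) (ht : (e : ℝ) + 1 ≤ ε * t)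
    (hk : (e + 1) ^ 2 * 2 ^ t < k) (hN : (N : ℝ) ≤ 2 * (k : ℝ) ^ (3 - 3 * ε)) :
    (k ^ e * ((e + 1) * k ^ 2)) ^ 2 * (k ^ (e - 1) * N) ^ t < (k ^ e * k ^ 2) ^ t := by
  have hk0 : 0 < k := by omega
  have hkR : (0 : ℝ) < k := by exact_mod_cast hk0
  have hk1 : (1 : ℝ) ≤ k := by exact_mod_cast hk0
  obtain ⟨f, rfl⟩ : ∃ f, e = f + 1 := ⟨e - 1, by omega⟩
  simp only [Nat.add_sub_cancel]
  -- the gain `k ^ (3 ε t) ≥ k ^ (3 d)` beats the number `(d k ^ (d + 1)) ^ 2` of pairs of points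
  have hNt : (N : ℝ) ^ t * (k : ℝ) ^ (3 * f + 6) ≤ 2 ^ t * (k : ℝ) ^ (3 * t) := by
    calc (N : ℝ) ^ t * (k : ℝ) ^ (3 * f + 6)
        ≤ (2 * (k : ℝ) ^ (3 - 3 * ε)) ^ t * (k : ℝ) ^ (3 * ε * t) := by
          gcongr
          rw [← Real.rpow_natCast]
          refine Real.rpow_le_rpow_of_exponent_le hk1 ?_
          push_cast at ht ⊢
          linarith
      _ = 2 ^ t * (k : ℝ) ^ (3 * t) := by
          rw [mul_pow, ← Real.rpow_mul_natCast hkR.le, mul_assoc, ← Real.rpow_add hkR,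
            ← Real.rpow_natCast _ (3 * t)]
          congr 2
          push_cast
          ring
  have hNt' : N ^ t * k ^ (3 * f + 6) ≤ 2 ^ t * k ^ (3 * t) := by exact_mod_cast hNt
  refine Nat.lt_of_mul_lt_mul_right (a := k ^ (3 * f + 6)) ?_
  calc (k ^ (f + 1) * ((f + 1 + 1) * k ^ 2)) ^ 2 * (k ^ f * N) ^ t * k ^ (3 * f + 6)
      = (f + 1 + 1) ^ 2 * k ^ (2 * f + 6) * k ^ (f * t) * (N ^ t * k ^ (3 * f + 6)) := by ring
    _ ≤ (f + 1 + 1) ^ 2 * k ^ (2 * f + 6) * k ^ (f * t) * (2 ^ t * k ^ (3 * t)) :=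
        Nat.mul_le_mul_left _ hNt'
    _ = ((f + 1 + 1) ^ 2 * 2 ^ t) * (k ^ (2 * f + 6) * k ^ (f * t) * k ^ (3 * t)) := by ring
    _ < k * (k ^ (2 * f + 6) * k ^ (f * t) * k ^ (3 * t)) :=
        Nat.mul_lt_mul_of_pos_right hk (by positivity)
    _ = k ^ (2 * f + 7) * k ^ ((f + 3) * t) := by ring
    _ ≤ k ^ (3 * f + 6) * k ^ ((f + 3) * t) :=
        Nat.mul_le_mul_right _ (Nat.pow_le_pow_right hk0 (by omega))
    _ = (k ^ (f + 1) * k ^ 2) ^ t * k ^ (3 * f + 6) := by ring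

/-! ### The configuration for a given number of points -/

theorem exists_nat_scale (D r k₀ m : ℕ) (hD : 0 < D) (hr : 0 < r) (hk₀ : 0 < k₀)
    (hm : D * k₀ ^ r ≤ m) : ∃ k, k₀ ≤ k ∧ D * k ^ r ≤ m ∧ m ≤ D * (2 * k) ^ r := by
  have hkm : ∀ k, k ≤ D * k ^ r := fun k =>
    (Nat.le_self_pow hr.ne' k).trans (Nat.le_mul_of_pos_left _ hD)
  refine ⟨Nat.findGreatest (fun k => D * k ^ r ≤ m) m,
    Nat.le_findGreatest ((hkm _).trans hm) hm,
    Nat.findGreatest_spec (P := fun k => D * k ^ r ≤ m) ((hkm _).trans hm) hm, ?_⟩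
  set k := Nat.findGreatest (fun k => D * k ^ r ≤ m) m with hk
  have hk1 : k₀ ≤ k := Nat.le_findGreatest ((hkm _).trans hm) hm
  by_contra! h
  have h1 : D * (2 * k) ^ r ≤ m := h.le
  have := Nat.le_findGreatest (P := fun k => D * k ^ r ≤ m) ((hkm _).trans h1) h1
  omega

open Classical in
/-- The configuration in terms of `e = d - 1`, with `β` for the exponent of `n`. Since
`m ≈ k ^ (d + 1)` and `n ≈ k ^ (3 - 3 ε)`, the number `n k ^ (d - 1)` of incidences has order
`k ^ (d + 2 - 3 ε)`, while `m ^ δ n ^ β` has order `k ^ (d + 2 - 3 ε - 3 ε β)`. -/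
theorem exists_lattice_constants (e : ℕ) (he : 2 ≤ e) (ε δ β : ℝ) (hε : 0 < ε) (hε1 : ε ≤ 1)
    (hδ : 0 < δ) (hβ : 0 ≤ β) (hβ' : 3 * β + δ * (e + 2) ≤ e + 3 - 3 * ε)
    (t : ℕ) (ht1 : 1 < t) (ht : (e : ℝ) + 1 ≤ ε * t) :
    ∃ c₁ c₂ c₃ : ℝ, 0 < c₁ ∧ 0 < c₂ ∧ 0 < c₃ ∧ ∀ m : ℕ, 1 ≤ m →
      ∃ P H : Finset ((Fin e → ℕ) × ℕ), #P = m ∧ PairsOnFewerThan t P H ∧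
        c₁ * (m : ℝ) ^ ((3 - 3 * ε) / ((e : ℝ) + 2)) ≤ (#H : ℝ) ∧
        (#H : ℝ) ≤ c₂ * (m : ℝ) ^ ((3 - 3 * ε) / ((e : ℝ) + 2)) ∧
        c₃ * ((m : ℝ) ^ δ * (#H : ℝ) ^ β) ≤
          (#{x ∈ P ×ˢ H | LatticeIncident x.1 x.2} : ℝ) := by
  set α := (3 - 3 * ε) / ((e : ℝ) + 2) with hα
  have hα0 : 0 ≤ α := div_nonneg (by linarith) (by positivity)
  have hαe : ((e : ℝ) + 2) * α = 3 - 3 * ε := by rw [hα]; field_simp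
  set k₀ : ℕ := (e + 1) ^ 2 * 2 ^ t + 1 with hk₀
  set A : ℝ := (e + 1) * 2 ^ (e + 2) with hA
  have hA0 : 0 < A := by positivity
  set M : ℝ := (e + 1) * (k₀ : ℝ) ^ (e + 2) with hM
  have hM0 : 0 < M := by positivity
  refine ⟨min (A ^ (-α)) (M ^ (-α)), 2, min (A ^ (-δ) * 2 ^ (-β)) (M ^ (-δ)), by positivity,
    by norm_num, by positivity, fun m hm => ?_⟩
  have hmR : (1 : ℝ) ≤ m := by exact_mod_cast hm
  have hm0 : (0 : ℝ) < m := by linarith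
  rcases le_or_gt ((e + 1) * k₀ ^ (e + 2)) m with hlarge | hsmall
  · obtain ⟨k, hk, hkm, hmk⟩ := exists_nat_scale (e + 1) (e + 2) k₀ m (by omega) (by omega)
      (by omega) hlarge
    have hk0 : 0 < k := by omega
    have hkR : (0 : ℝ) < k := by exact_mod_cast hk0
    have hk1 : (1 : ℝ) ≤ k := by exact_mod_cast hk0
    have hmA : (m : ℝ) ≤ A * (k : ℝ) ^ ((e : ℝ) + 2) := by
      have : (m : ℝ) ≤ (e + 1) * (2 * k) ^ (e + 2) := by exact_mod_cast hmk
      refine this.trans_eq ?_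
      rw [hA, mul_pow, ← mul_assoc, ← Real.rpow_natCast (k : ℝ)]
      push_cast
      rfl
    have hkm' : (k : ℝ) ^ ((e : ℝ) + 2) ≤ m := by
      have h1 : k ^ (e + 2) ≤ m := (Nat.le_mul_of_pos_left _ (by omega)).trans hkm
      have : (k : ℝ) ^ (e + 2) ≤ m := by exact_mod_cast h1
      rw [← Real.rpow_natCast] at this
      push_cast at this
      exact this
    have hx1 : 1 ≤ (k : ℝ) ^ (3 - 3 * ε) := Real.one_le_rpow hk1 (by linarith)
    set N := ⌈(k : ℝ) ^ (3 - 3 * ε)⌉₊ with hN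
    have hNlow : (k : ℝ) ^ (3 - 3 * ε) ≤ N := Nat.le_ceil _
    have hNup : (N : ℝ) ≤ 2 * (k : ℝ) ^ (3 - 3 * ε) := by
      have := Nat.ceil_lt_add_one (zero_le_one.trans hx1)
      linarith
    have hNU : N ≤ k ^ e * k ^ 2 := by
      refine Nat.ceil_le.2 ?_
      push_cast
      rw [← pow_add, ← Real.rpow_natCast]
      refine Real.rpow_le_rpow_of_exponent_le hk1 ?_
      have : (2 : ℝ) ≤ e := by exact_mod_cast he
      push_cast
      linarith
    obtain ⟨P, H, hPm, hHN, hPH, hI⟩ := exists_lattice_configuration (ι := Fin e) (D := e + 1)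
      (k := k) (N := N) (t := t) (m := m) (by simp) (by omega) (by simpa using hNU)
      (by rw [Fintype.card_fin]; refine le_of_eq_of_le ?_ hkm; ring)
      (by simpa using sample_bound he ht (by omega) hNup)
    refine ⟨P, H, hPm, hPH, ?_, ?_, ?_⟩
    · rw [hHN]
      refine le_trans ?_ hNlow
      calc min (A ^ (-α)) (M ^ (-α)) * (m : ℝ) ^ α
          ≤ A ^ (-α) * (A * (k : ℝ) ^ ((e : ℝ) + 2)) ^ α := by
            gcongr
            exact min_le_left _ _
        _ = (k : ℝ) ^ (3 - 3 * ε) := by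
            rw [Real.mul_rpow hA0.le (by positivity), ← mul_assoc, ← Real.rpow_add hA0,
              ← Real.rpow_mul hkR.le, hαe]
            simp
    · rw [hHN]
      refine hNup.trans ?_
      gcongr
      calc (k : ℝ) ^ (3 - 3 * ε) = ((k : ℝ) ^ ((e : ℝ) + 2)) ^ α := by
            rw [← Real.rpow_mul hkR.le, hαe]
        _ ≤ (m : ℝ) ^ α := by gcongr
    · rw [hHN]
      calc min (A ^ (-δ) * 2 ^ (-β)) (M ^ (-δ)) * ((m : ℝ) ^ δ * (N : ℝ) ^ β)
          ≤ A ^ (-δ) * 2 ^ (-β) * ((A * (k : ℝ) ^ ((e : ℝ) + 2)) ^ δ *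
              (2 * (k : ℝ) ^ (3 - 3 * ε)) ^ β) := by
            gcongr
            exact min_le_left _ _
        _ = (k : ℝ) ^ (((e : ℝ) + 2) * δ + (3 - 3 * ε) * β) := by
            rw [Real.mul_rpow hA0.le (by positivity), Real.mul_rpow zero_le_two (by positivity),
              ← Real.rpow_mul hkR.le, ← Real.rpow_mul hkR.le, Real.rpow_neg hA0.le,
              Real.rpow_neg zero_le_two, Real.rpow_add hkR]
            field_simp
        _ ≤ (k : ℝ) ^ ((3 - 3 * ε) + e) := by
            refine Real.rpow_le_rpow_of_exponent_le hk1 ?_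
            nlinarith [mul_nonneg hε.le hβ]
        _ ≤ N * (k : ℝ) ^ e := by
            rw [Real.rpow_add hkR, Real.rpow_natCast]
            gcongr
        _ ≤ _ := by
            rw [Fintype.card_fin] at hI
            exact_mod_cast hI
  · obtain ⟨P, H, hPm, hHN, hPH, hI⟩ := exists_single_configuration (ι := Fin e) ht1 hm
    have hmM : (m : ℝ) ≤ M := by
      have : m ≤ (e + 1) * k₀ ^ (e + 2) := hsmall.le
      rw [hM]
      exact_mod_cast this
    refine ⟨P, H, hPm, hPH, ?_, ?_, ?_⟩
    · rw [hHN]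
      calc min (A ^ (-α)) (M ^ (-α)) * (m : ℝ) ^ α ≤ M ^ (-α) * M ^ α := by
            gcongr
            exact min_le_right _ _
        _ = ((1 : ℕ) : ℝ) := by rw [← Real.rpow_add hM0]; simp
    · rw [hHN]
      have := Real.one_le_rpow hmR hα0
      push_cast
      linarith
    · rw [hHN]
      calc min (A ^ (-δ) * 2 ^ (-β)) (M ^ (-δ)) * ((m : ℝ) ^ δ * ((1 : ℕ) : ℝ) ^ β)
          ≤ M ^ (-δ) * (M ^ δ * 1) := by
            gcongr
            · exact min_le_right _ _
            · simp
        _ = 1 := by rw [mul_one, ← Real.rpow_add hM0]; simp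
        _ ≤ _ := by exact_mod_cast hI

/-! ### From the lattice to hypersurfaces -/

open Classical in
/-- A lattice configuration is carried to `ℝ^(e+1)` by maps `φ` of points and `ψ` of hyperplanes
that preserve and reflect incidence. These maps may depend on a bound `K` for the squared norm of
the `x`-part of the points; spheres need this. -/
theorem hasConfiguration_of_realization {e m : ℕ} {ε δ c₁ c₂ c₃ : ℝ}
    {C : Set (EuclideanSpace ℝ (Fin (e + 1))) → Prop} (P H : Finset ((Fin e → ℕ) × ℕ))
    (hPm : #P = m) (hPH : PairsOnFewerThan ⌈((e + 1 : ℕ) : ℝ) / ε⌉₊ P H)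
    (h₁ : c₁ * (m : ℝ) ^ ((3 - 3 * ε) / (((e + 1 : ℕ) : ℝ) + 1)) ≤ (#H : ℝ))
    (h₂ : (#H : ℝ) ≤ c₂ * (m : ℝ) ^ ((3 - 3 * ε) / (((e + 1 : ℕ) : ℝ) + 1)))
    (h₃ : c₃ * ((m : ℝ) ^ δ *
        (#H : ℝ) ^ ((((e + 1 : ℕ) : ℝ) + 2 - δ * (((e + 1 : ℕ) : ℝ) + 1)) / 3 - ε)) ≤
      (#{x ∈ P ×ˢ H | LatticeIncident x.1 x.2} : ℝ))
    (hreal : ∀ K : ℕ, 1 ≤ K → ∃ (φ : (Fin e → ℕ) × ℕ → EuclideanSpace ℝ (Fin (e + 1)))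
      (ψ : (Fin e → ℕ) × ℕ → Set (EuclideanSpace ℝ (Fin (e + 1)))),
      Set.InjOn φ {p | ∑ i, p.1 i ^ 2 ≤ K} ∧ (∀ h, C (ψ h)) ∧
      ∀ p, ∑ i, p.1 i ^ 2 ≤ K → ∀ h, φ p ∈ ψ h ↔ LatticeIncident p h) :
    HasConfiguration (e + 1) ε δ c₁ c₂ c₃ m C := by
  let K := P.sup (fun p => ∑ i, p.1 i ^ 2) + 1
  have hK : 1 ≤ K := Nat.le_add_left _ _
  have hPK : ∀ p ∈ P, ∑ i, p.1 i ^ 2 ≤ K := fun p hp =>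
    (Finset.le_sup (f := fun p : (Fin e → ℕ) × ℕ => ∑ i, p.1 i ^ 2) hp).trans (Nat.le_succ _)
  obtain ⟨φ, ψ, hφ, hC, hφψ⟩ := hreal K hK
  have hφP : Set.InjOn φ P := hφ.mono fun p hp => hPK p hp
  -- `ψ (a, b)` determines `(a, b)` through its incidences with the images of `(0, b)`, `(eᵢ, aᵢ + b)`
  have hψ : Function.Injective ψ := by
    intro h h' e'
    have hiff : ∀ p : (Fin e → ℕ) × ℕ, ∑ i, p.1 i ^ 2 ≤ K → LatticeIncident p h →
        LatticeIncident p h' := fun p hp hi => by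
      rw [← hφψ p hp, ← e', hφψ p hp]; exact hi
    have hb : h.2 = h'.2 := by
      simpa [LatticeIncident] using hiff (0, h.2) (by simp) (by simp [LatticeIncident])
    have ha : ∀ i, h.1 i = h'.1 i := fun i => by
      have := hiff (Pi.single i 1, h.1 i + h.2)
        (by simpa [Pi.single_apply] using hK)
        (by simp [LatticeIncident, Pi.single_apply])
      simpa [LatticeIncident, Pi.single_apply, hb] using this
    exact Prod.ext (funext ha) hb
  have hHc : #(H.image ψ) = #H := Finset.card_image_of_injective _ hψ
  refine ⟨P.image φ, H.image ψ, ?_, ?_, ?_, ?_, ?_, ?_⟩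
  · rw [Finset.card_image_of_injOn hφP, hPm]
  · intro V hV
    obtain ⟨h, -, rfl⟩ := Finset.mem_image.1 hV
    exact hC h
  · rw [hHc]; exact h₁
  · rw [hHc]; exact h₂
  · rintro ⟨A, hA, B, hB, hA2, hBt, hAB⟩
    obtain ⟨x, y, hxy, rfl⟩ := Finset.card_eq_two.1 hA2
    obtain ⟨p, hp, rfl⟩ := Finset.mem_image.1 (hA (Finset.mem_insert_self x _))
    obtain ⟨q, hq, rfl⟩ := Finset.mem_image.1
      (hA (Finset.mem_insert_of_mem (Finset.mem_singleton_self y)))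
    refine absurd (hPH p hp q hq fun h => hxy (h ▸ rfl)) (not_lt.2 ?_)
    rw [← hBt]
    refine (Finset.card_le_card fun V hV => ?_).trans (Finset.card_image_le (f := ψ)
      (s := {h ∈ H | LatticeIncident p h ∧ LatticeIncident q h}))
    obtain ⟨h, hh, rfl⟩ := Finset.mem_image.1 (hB hV)
    refine Finset.mem_image_of_mem _ (Finset.mem_filter.2 ⟨hh, ?_, ?_⟩)
    · exact (hφψ p (hPK p hp) h).1 (hAB _ (by simp) _ hV)
    · exact (hφψ q (hPK q hq) h).1 (hAB _ (by simp) _ hV)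
  · rw [hHc]
    refine h₃.trans (Nat.cast_le.2 ?_)
    have hfin : {z : EuclideanSpace ℝ (Fin (e + 1)) × Set (EuclideanSpace ℝ (Fin (e + 1))) |
        z.1 ∈ P.image φ ∧ z.2 ∈ H.image ψ ∧ z.1 ∈ z.2}.Finite :=
      ((P.image φ ×ˢ H.image ψ).finite_toSet).subset fun z hz => by
        simpa only [Finset.mem_coe, Finset.mem_product] using And.intro hz.1 hz.2.1
    unfold incidences
    rw [← Set.ncard_coe_finset]
    refine Set.ncard_le_ncard_of_injOn (fun z => (φ z.1, ψ z.2)) ?_ ?_ hfin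
    · intro z hz
      simp only [Finset.mem_coe, Finset.mem_filter, Finset.mem_product] at hz
      exact ⟨Finset.mem_image_of_mem _ hz.1.1, Finset.mem_image_of_mem _ hz.1.2,
        (hφψ _ (hPK _ hz.1.1) _).2 hz.2⟩
    · intro z hz w hw hzw
      simp only [Finset.mem_coe, Finset.mem_filter, Finset.mem_product] at hz hw
      obtain ⟨h1, h2⟩ := Prod.mk.inj hzw
      exact Prod.ext (hφP hz.1.1 hw.1.1 h1) (hψ h2)

/-- The point `(x, y)` of `ℝ^(e+1)`, with `y` as its last coordinate. -/
noncomputable def snocPoint {e : ℕ} (x : Fin e → ℕ) (y : ℝ) : EuclideanSpace ℝ (Fin (e + 1)) :=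
  WithLp.toLp 2 (Fin.snoc (α := fun _ => ℝ) (fun i => (x i : ℝ)) y)

@[simp] theorem snocPoint_castSucc {e : ℕ} (x : Fin e → ℕ) (y : ℝ) (i : Fin e) :
    snocPoint x y i.castSucc = x i := by simp [snocPoint]

@[simp] theorem snocPoint_last {e : ℕ} (x : Fin e → ℕ) (y : ℝ) :
    snocPoint x y (Fin.last e) = y := by simp [snocPoint]

theorem snocPoint_inj {e : ℕ} {x x' : Fin e → ℕ} {y y' : ℝ} :
    snocPoint x y = snocPoint x' y' ↔ x = x' ∧ y = y' := by
  refine ⟨fun h => ⟨funext fun i => ?_, ?_⟩, by rintro ⟨rfl, rfl⟩; rfl⟩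
  · have := congrArg (fun v => v i.castSucc) h
    simpa using this
  · have := congrArg (fun v => v (Fin.last e)) h
    simpa using this

theorem latticeIncident_iff_real {e : ℕ} (p h : (Fin e → ℕ) × ℕ) :
    LatticeIncident p h ↔ (p.2 : ℝ) = ∑ i, (h.1 i : ℝ) * p.1 i + h.2 := by
  unfold LatticeIncident
  exact_mod_cast Iff.rfl

theorem mem_graphOf_succ {e : ℕ} (f : (Fin e → ℝ) → ℝ) (v : EuclideanSpace ℝ (Fin (e + 1))) :
    v ∈ graphOf (d := e + 1) (Nat.succ_pos e) f ↔ v (Fin.last e) = f fun i => v i.castSucc :=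
  Iff.rfl

/-- The points `(x, f x + y)` and the graphs of `f x + a · x + b` have the incidences of the lattice
points `(x, y)` and the hyperplanes `y = a · x + b`. -/
theorem graph_realization {e : ℕ} (f : (Fin e → ℝ) → ℝ) :
    ∃ φ : (Fin e → ℕ) × ℕ → EuclideanSpace ℝ (Fin (e + 1)), Function.Injective φ ∧ ∀ p h,
      φ p ∈ graphOf (d := e + 1) (Nat.succ_pos e) (fun x => f x + ∑ i, (h.1 i : ℝ) * x i + h.2) ↔
        LatticeIncident p h := by
  refine ⟨fun p => snocPoint p.1 (f (fun i => (p.1 i : ℝ)) + p.2), fun p q hpq => ?_, fun p h => ?_⟩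
  · obtain ⟨h1, h2⟩ := snocPoint_inj.1 hpq
    rw [h1] at h2
    exact Prod.ext h1 (by simpa using h2)
  · rw [mem_graphOf_succ, latticeIncident_iff_real]
    simp [add_assoc]

/-- The summand `0` makes the function literally a modification of `fun _ => 0`, as in
`graph_realization`. -/
theorem isHyperplane_graphOf {e : ℕ} (a : Fin e → ℝ) (b : ℝ) :
    IsHyperplane (graphOf (d := e + 1) (Nat.succ_pos e) fun x => 0 + ∑ i, a i * x i + b) := by
  refine ⟨WithLp.toLp 2 (Fin.snoc (α := fun _ => ℝ) a (-1)), -b, fun h => ?_, ?_⟩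
  · have := congrArg (fun v => v (Fin.last e)) h
    simp at this
  · ext v
    rw [mem_graphOf_succ (e := e)]
    simp only [Fin.sum_univ_castSucc, Fin.snoc_castSucc, Fin.snoc_last, Set.mem_ofPred_eq]
    constructor <;> intro h <;> linarith

/-- The points `(x, √(y + K - ‖x‖²))` and the spheres with centre `(a / 2, 0)` and squared radius
`b + K + ‖a / 2‖²` have the incidences of the lattice points `(x, y)` and the hyperplanes
`y = a · x + b`: the quadratic terms of the equation of the sphere add up to `y + K`. -/
theorem sphere_realization {e : ℕ} (K : ℕ) (hK : 1 ≤ K) :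
    ∃ (φ : (Fin e → ℕ) × ℕ → EuclideanSpace ℝ (Fin (e + 1)))
      (ψ : (Fin e → ℕ) × ℕ → Set (EuclideanSpace ℝ (Fin (e + 1)))),
      Set.InjOn φ {p | ∑ i, p.1 i ^ 2 ≤ K} ∧ (∀ h, IsHypersphere (ψ h)) ∧
      ∀ p, ∑ i, p.1 i ^ 2 ≤ K → ∀ h, φ p ∈ ψ h ↔ LatticeIncident p h := by
  have hnn : ∀ p : (Fin e → ℕ) × ℕ, ∑ i, p.1 i ^ 2 ≤ K →
      0 ≤ (p.2 : ℝ) + K - ∑ i, (p.1 i : ℝ) ^ 2 := fun p hp => by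
    have : ∑ i, (p.1 i : ℝ) ^ 2 ≤ K := by exact_mod_cast hp
    have : (0 : ℝ) ≤ p.2 := Nat.cast_nonneg _
    linarith
  have hpos : ∀ h : (Fin e → ℕ) × ℕ, 0 < (h.2 : ℝ) + K + ∑ i, ((h.1 i : ℝ) / 2) ^ 2 := fun h => by
    have : (1 : ℝ) ≤ K := by exact_mod_cast hK
    positivity
  refine ⟨fun p => snocPoint p.1 √((p.2 : ℝ) + K - ∑ i, (p.1 i : ℝ) ^ 2), fun h => Metric.sphere
    (WithLp.toLp 2 (Fin.snoc (α := fun _ => ℝ) (fun i => (h.1 i : ℝ) / 2) 0))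
    √((h.2 : ℝ) + K + ∑ i, ((h.1 i : ℝ) / 2) ^ 2), ?_, ?_, ?_⟩
  · intro p hp q hq hpq
    obtain ⟨h1, h2⟩ := snocPoint_inj.1 hpq
    rw [Real.sqrt_inj (hnn p hp) (hnn q hq), h1] at h2
    refine Prod.ext h1 ?_
    have : (p.2 : ℝ) = q.2 := by linarith
    exact_mod_cast this
  · exact fun h => ⟨_, _, Real.sqrt_pos.2 (hpos h), rfl⟩
  · intro p hp h
    rw [mem_sphere_iff_norm, EuclideanSpace.norm_eq, Real.sqrt_inj (by positivity) (hpos h).le,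
      latticeIncident_iff_real, Fin.sum_univ_castSucc]
    simp only [PiLp.sub_apply, snocPoint_castSucc, snocPoint_last, Fin.snoc_castSucc, Fin.snoc_last,
      sub_zero, Real.norm_eq_abs, sq_abs, Real.sq_sqrt (hnn p hp)]
    have hexpand : ∑ i, ((p.1 i : ℝ) - (h.1 i : ℝ) / 2) ^ 2 =
        ∑ i, (p.1 i : ℝ) ^ 2 - ∑ i, (h.1 i : ℝ) * p.1 i + ∑ i, ((h.1 i : ℝ) / 2) ^ 2 := by
      rw [← Finset.sum_sub_distrib, ← Finset.sum_add_distrib]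
      exact Finset.sum_congr rfl fun i _ => by ring
    rw [hexpand]
    constructor <;> intro h <;> linarith

theorem theorem4 (d : ℕ) (hd : 4 ≤ d) (ε δ : ℝ) (hε : 0 < ε) (hδ : 0 < δ)
    (hε1 : ε ≤ 1) (hexp : 0 ≤ ((d : ℝ) + 2 - δ * ((d : ℝ) + 1)) / 3 - ε) :
    ∃ c₁ c₂ c₃ : ℝ, 0 < c₁ ∧ 0 < c₂ ∧ 0 < c₃ ∧ ∀ m : ℕ, 1 ≤ m →
      HasConfiguration d ε δ c₁ c₂ c₃ m IsHyperplane ∧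
      HasConfiguration d ε δ c₁ c₂ c₃ m IsHypersphere ∧
      ∀ F : Set (Set (EuclideanSpace ℝ (Fin d))),
        F.Nonempty → IsLinearlyClosed (show 0 < d by omega) F →
          HasConfiguration d ε δ c₁ c₂ c₃ m (fun V => V ∈ F) := by
  obtain ⟨e, rfl⟩ : ∃ e, d = e + 1 := ⟨d - 1, by omega⟩
  have hcast : ((e + 1 : ℕ) : ℝ) + 1 = (e : ℝ) + 2 := by push_cast; ring
  have ht : (e : ℝ) + 1 ≤ ε * ⌈((e + 1 : ℕ) : ℝ) / ε⌉₊ := by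
    have := (div_le_iff₀' hε).1 (Nat.le_ceil (((e + 1 : ℕ) : ℝ) / ε))
    simpa using this
  have ht1 : 1 < ⌈((e + 1 : ℕ) : ℝ) / ε⌉₊ := by
    refine Nat.lt_ceil.2 ((lt_div_iff₀ hε).2 ?_)
    have : (4 : ℝ) ≤ ((e + 1 : ℕ) : ℝ) := by exact_mod_cast hd
    push_cast at this ⊢
    linarith
  obtain ⟨c₁, c₂, c₃, hc₁, hc₂, hc₃, hc⟩ := exists_lattice_constants e (by omega) ε δ _ hε hε1 hδ
    hexp (by push_cast; linarith) _ ht1 ht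
  refine ⟨c₁, c₂, c₃, hc₁, hc₂, hc₃, fun m hm => ?_⟩
  obtain ⟨P, H, hPm, hPH, h₁, h₂, h₃⟩ := hc m hm
  rw [← hcast] at h₁ h₂
  refine ⟨?_, ?_, fun F hF hFc => ?_⟩
  · obtain ⟨φ, hφ, hφψ⟩ := graph_realization (e := e) fun _ => 0
    exact hasConfiguration_of_realization P H hPm hPH h₁ h₂ h₃ fun K _ =>
      ⟨φ, _, hφ.injOn, fun h => isHyperplane_graphOf _ _, fun p _ h => hφψ p h⟩
  · exact hasConfiguration_of_realization P H hPm hPH h₁ h₂ h₃ sphere_realization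
  · obtain ⟨V, hV⟩ := hF
    obtain ⟨f, rfl⟩ := hFc.1 V hV
    obtain ⟨φ, hφ, hφψ⟩ := graph_realization (e := e) f
    exact hasConfiguration_of_realization P H hPm hPH h₁ h₂ h₃ fun K _ =>
      ⟨φ, _, hφ.injOn, fun h => hFc.2 f hV (fun i => (h.1 i : ℝ)) h.2, fun p _ h => hφψ p h⟩
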